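/- Let $d\ge 2$, $\sigma_1,\sigma_2\in\mathbb R$ with $\sigma_1\neq 0$, $\nu\ge 0$, $T>0$. Let $\Phi$ be the fundamental solution of the Laplacian on $\mathbb R^d$ ($\Delta\Phi=\delta$): $\Phi(x)=\frac1{2\pi}\log|x|$ if $d=2$, and $\Phi(x)=-\frac{|x|^{2-d}}{(d-2)|S^{d-1}|}$ if $d\ge 3$. Write $\|\cdot\|$ for the norm of $L^2(\mathbb R^d)$ and $m(f)=\int_{\mathbb R^d} f$ for the total mass of $f \in L^1(\mathbb R^d)$. For $\rho_0\in L^1\cap L^\infty(\mathbb R^d)$, a weak solution on $[0,T]$, with initial density $\rho_0$, of $$\partial_t\rho^\nu+\mathbf v^\nu\cdot\nabla\rho^\nu=\sigma_2(\rho^\nu)^2+\nu\Delta\rho^\nu,\qquad \mathbf v^\nu=\sigma_1\nabla\Phi*\rho^\nu$$ is a $\rho^\nu\in L^\infty(0,T;L^1\cap L^\infty)\cap C([0,T];L^2)$ with $\rho^\nu(0)=\rho_0$, $\partial_t\rho^\nu\in L^2(0,T;H^{-1})$, $\rho^\nu\in L^2(0,T;H^1)$ if $\nu>0$, and $$\int_0^T\!\!\int_{\mathbb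 R^d}\Big(\rho^\nu\partial_t\varphi+\rho^\nu\mathbf v^\nu\cdot\nabla\varphi+(\sigma_1+\sigma_2)(\rho^\nu)^2\varphi-\nu\nabla\rho^\nu\cdot\nabla\varphi\Big)\,dx\,dt+\int_{\mathbb R^d}\rho_0\,\varphi(0,\cdot)\,dx=0$$ for all $\varphi\in C_c^\infty([0,T)\times\mathbb R^d)$. Let $a\in C^\infty(\mathbb R^d)$ be radially symmetric, supported in the ball $B_2(0)$, identically $1$ on $B_1(0)$, and nonincreasing in $|x|$; put $a_R(x)=a(x/R)$ and $b_R=1-a_R$. **Theorem (total mass identity).** Let $\rho_0\in L^1\cap L^\infty(\mathbb R^d)$ and suppose that for some real numbers $C$, $N>d+1$ and $R_0>0$ we have $\|b_R\rho_0\|^2\le CR^{-N}$ for all $R\ge R_0$. Let $\rho^\nu$ be a weak solution on $[0,T]$ with initial density $\rho_0$. Then for every $t\in[0,T]$, $\rho^\nu(t)\in L^1(\mathbb R^d)$ and $$m(\rho^\nu(t))=m(\rho_0)+(\sigma_1+\sigma_2)\int_0^t\|\rho^\nu(s)\|^2\,ds .$$ In particular, if $\rho^\nu$ does not vanish identically on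 $[0,T]$, then mass is conserved, that is, $m(\rho^\nu(t))=m(\rho_0)$ for all $t\in[0,T]$, if and only if $\sigma_1+\sigma_2=0$. -/

import Mathlib

open MeasureTheory Set Filter Topology
open scoped ENNReal NNReal ContDiff RealInnerProductSpace Convolution

noncomputable section

namespace GAG

/-- The Euclidean space `ℝ^d`. -/
abbrev Space (d : ℕ) := EuclideanSpace ℝ (Fin d)

/-- The real Hilbert space `L²(ℝ^d)`. -/
abbrev L2 (d : ℕ) := Lp ℝ 2 (volume : Measure (Space d))

/-- The real Hilbert space of square integrable vector fields on `ℝ^d`. -/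
abbrev L2Vec (d : ℕ) := Lp (Space d) 2 (volume : Measure (Space d))

/-! ### Cutoff functions -/

/-- A radially symmetric, radially nonincreasing `C^∞` function supported in the ball of radius `2`
and identically `1` on the ball of radius `1`. -/
structure IsRadialCutoff {d : ℕ} (a : Space d → ℝ) : Prop where
  smooth : ContDiff ℝ ∞ a
  radial : ∀ x y, ‖x‖ = ‖y‖ → a x = a y
  support_subset : Function.support a ⊆ Metric.ball 0 2
  eq_one : ∀ x ∈ Metric.ball (0 : Space d) 1, a x = 1
  nonincreasing : ∀ x y, ‖x‖ ≤ ‖y‖ → a y ≤ a x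

/-- `a_R(x) = a(x / R)`. -/
def aR {d : ℕ} (a : Space d → ℝ) (R : ℝ) (x : Space d) : ℝ := a (R⁻¹ • x)

/-- `b_R = 1 - a_R`. -/
def bR {d : ℕ} (a : Space d → ℝ) (R : ℝ) (x : Space d) : ℝ := 1 - aR a R x

/-! ### Newtonian potential, velocity, mass -/

/-- The surface area of the unit sphere of `ℝ^d`, that is `d` times the volume of the unit ball. -/
def sphereArea (d : ℕ) : ℝ := d * volume.real (Metric.ball (0 : Space d) 1)

/-- The fundamental solution of the Laplacian on `ℝ^d`, `d ≥ 2`, normalized by `ΔΦ = δ`. -/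
def newtonian (d : ℕ) (x : Space d) : ℝ :=
  if d = 2 then (2 * Real.pi)⁻¹ * Real.log ‖x‖
  else -(((d : ℝ) - 2) * sphereArea d)⁻¹ * ‖x‖ ^ (2 - (d : ℝ))

/-- The velocity `σ₁ ∇Φ * ρ`. -/
def velocity {d : ℕ} (σ₁ : ℝ) (ρ : Space d → ℝ) (x : Space d) : Space d :=
  σ₁ • (ρ ⋆[ContinuousLinearMap.lsmul ℝ ℝ, volume] gradient (newtonian d)) x

/-- The total mass `m(f) = ∫ f`. -/
def totalMass {d : ℕ} (f : Space d → ℝ) : ℝ := ∫ x, f x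

/-! ### The Sobolev space `H¹` and its dual -/

/-- `G` is the weak (distributional) gradient of `f`. -/
def IsWeakGradient {d : ℕ} (f : L2 d) (G : L2Vec d) : Prop :=
  ∀ ψ : Space d → ℝ, ContDiff ℝ ∞ ψ → HasCompactSupport ψ →
    ∫ x, f x • gradient ψ x = -∫ x, ψ x • G x

theorem memLp_test {d : ℕ} {ψ : Space d → ℝ} (h1 : ContDiff ℝ ∞ ψ) (h2 : HasCompactSupport ψ) :
    MemLp ψ 2 (volume : Measure (Space d)) :=
  h1.continuous.memLp_of_hasCompactSupport h2

theorem memLp_gradient_test {d : ℕ} {ψ : Space d → ℝ} (h1 : ContDiff ℝ ∞ ψ)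
    (h2 : HasCompactSupport ψ) : MemLp (gradient ψ) 2 (volume : Measure (Space d)) := by
  have hc : Continuous (gradient ψ) :=
    (InnerProductSpace.toDual ℝ (Space d)).symm.continuous.comp
      (h1.continuous_fderiv (by simp))
  refine hc.memLp_of_hasCompactSupport ?_
  exact (h2.fderiv (𝕜 := ℝ)).comp_left
    (g := (InnerProductSpace.toDual ℝ (Space d)).symm) (by simp)

theorem integrable_smul_of_memLp_two {d : ℕ} {f : Space d → ℝ} {G : Space d → Space d}
    (hf : MemLp f 2 volume) (hG : MemLp G 2 volume) : Integrable (fun x => f x • G x) volume :=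
  memLp_one_iff_integrable.mp (hG.smul hf)

theorem IsWeakGradient.add {d : ℕ} {f f' : L2 d} {G G' : L2Vec d}
    (h : IsWeakGradient f G) (h' : IsWeakGradient f' G') :
    IsWeakGradient (f + f') (G + G') := by
  intro ψ h1 h2
  have e1 : ∫ x, (f + f') x • gradient ψ x
      = ∫ x, (f x • gradient ψ x + f' x • gradient ψ x) := by
    refine integral_congr_ae ?_
    filter_upwards [Lp.coeFn_add f f'] with x hx
    rw [hx, Pi.add_apply, add_smul]
  have e2 : ∫ x, ψ x • (G + G') x = ∫ x, (ψ x • G x + ψ x • G' x) := by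
    refine integral_congr_ae ?_
    filter_upwards [Lp.coeFn_add G G'] with x hx
    rw [hx, Pi.add_apply, smul_add]
  have hg := memLp_gradient_test h1 h2
  have hψ := memLp_test h1 h2
  rw [e1, e2, integral_add (integrable_smul_of_memLp_two (Lp.memLp f) hg)
      (integrable_smul_of_memLp_two (Lp.memLp f') hg),
    integral_add (integrable_smul_of_memLp_two hψ (Lp.memLp G))
      (integrable_smul_of_memLp_two hψ (Lp.memLp G')),
    h ψ h1 h2, h' ψ h1 h2]
  abel

theorem IsWeakGradient.smul {d : ℕ} {f : L2 d} {G : L2Vec d} (c : ℝ)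
    (h : IsWeakGradient f G) : IsWeakGradient (c • f) (c • G) := by
  intro ψ h1 h2
  have e1 : ∫ x, (c • f) x • gradient ψ x = ∫ x, c • (f x • gradient ψ x) := by
    refine integral_congr_ae ?_
    filter_upwards [Lp.coeFn_smul c f] with x hx
    rw [hx, Pi.smul_apply, smul_assoc]
  have e2 : ∫ x, ψ x • (c • G) x = ∫ x, c • (ψ x • G x) := by
    refine integral_congr_ae ?_
    filter_upwards [Lp.coeFn_smul c G] with x hx
    rw [hx, Pi.smul_apply, smul_comm]
  rw [e1, e2, integral_smul, integral_smul, h ψ h1 h2, smul_neg]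

theorem isWeakGradient_zero {d : ℕ} : IsWeakGradient (0 : L2 d) (0 : L2Vec d) := by
  intro ψ _ _
  have e1 : ∫ x, (0 : L2 d) x • gradient ψ x = ∫ _ : Space d, (0 : Space d) := by
    refine integral_congr_ae ?_
    filter_upwards [Lp.coeFn_zero ℝ 2 (volume : Measure (Space d))] with x hx
    rw [hx, Pi.zero_apply, zero_smul]
  have e2 : ∫ x, ψ x • (0 : L2Vec d) x = ∫ _ : Space d, (0 : Space d) := by
    refine integral_congr_ae ?_
    filter_upwards [Lp.coeFn_zero (Space d) 2 (volume : Measure (Space d))] with x hx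
    rw [hx, Pi.zero_apply, smul_zero]
  rw [e1, e2]
  simp

/-- The weak gradient is unique. -/
theorem IsWeakGradient.unique {d : ℕ} {f : L2 d} {G G' : L2Vec d}
    (h : IsWeakGradient f G) (h' : IsWeakGradient f G') : G = G' := by
  have hl : ∀ F : L2Vec d, LocallyIntegrable F (volume : Measure (Space d)) := fun F =>
    (Lp.memLp F).locallyIntegrable (by norm_num)
  have key := ae_eq_of_integral_contDiff_smul_eq (hl G) (hl G') (fun ψ h1 h2 => by
    have := (h ψ h1 h2).symm.trans (h' ψ h1 h2)
    exact neg_injective this)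
  exact Lp.ext key

/-- The Sobolev space `H¹(ℝ^d)`, as the space of pairs `(f, ∇f)` with
`‖f‖_{H¹}² = ‖f‖² + ‖∇f‖²`. -/
def H1 (d : ℕ) : Submodule ℝ (WithLp 2 (L2 d × L2Vec d)) where
  carrier := {p | IsWeakGradient p.fst p.snd}
  add_mem' h h' := IsWeakGradient.add h h'
  zero_mem' := isWeakGradient_zero
  smul_mem' c _ h := IsWeakGradient.smul c h

/-- The function in `L²` underlying an element of `H¹`. -/
def toL2 {d : ℕ} (u : H1 d) : L2 d := (u : WithLp 2 (L2 d × L2Vec d)).fst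

/-- `H^{-1}(ℝ^d)`, the dual of `H¹(ℝ^d)`. -/
abbrev HNeg1 (d : ℕ) := StrongDual ℝ (H1 d)

open Classical in
/-- The weak gradient of `f` when it exists in `L²` (it is then unique), and `0` otherwise. -/
def weakGrad {d : ℕ} (f : L2 d) : L2Vec d :=
  if h : ∃ G, IsWeakGradient f G then h.choose else 0

/-! ### Weak solutions -/

/-- `ρ ∈ L^∞(0, T; L¹ ∩ L^∞)`, where `‖f‖_{L¹ ∩ L^∞} = ‖f‖_{L¹} + ‖f‖_{L^∞}`. -/
def BoundedL1Linf {d : ℕ} (T : ℝ) (ρ : ℝ → L2 d) : Prop :=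
  ∃ M : ℝ≥0, ∀ᵐ t ∂(volume.restrict (Ioo 0 T)),
    eLpNorm (ρ t) 1 volume + eLpNorm (ρ t) ∞ volume ≤ M

/-- `g = ∂_t ρ` in the sense of distributions on `(0, T)` with values in `H^{-1}`, where
`f ∈ L²` acts on `H¹` by `w ↦ ⟪f, w⟫`. -/
def IsTimeDerivative {d : ℕ} (T : ℝ) (ρ : ℝ → L2 d) (g : ℝ → HNeg1 d) : Prop :=
  ∀ η : ℝ → ℝ, ContDiff ℝ ∞ η → HasCompactSupport η → tsupport η ⊆ Ioo 0 T →
    ∀ w : H1 d, ∫ t in Ioo 0 T, deriv η t * ⟪ρ t, toL2 w⟫ = -∫ t in Ioo 0 T, η t * g t w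

/-- `ρ` is a weak solution on `[0, T]`, with initial density `ρ₀`, of
`∂_t ρ + v · ∇ρ = σ₂ ρ² + ν Δρ`, `v = σ₁ ∇Φ * ρ`. The test functions are those in
`C_c^∞([0, T) × ℝ^d)`, so they need not vanish at time `0`, which gives the term with `ρ₀`. -/
structure IsWeakSolution {d : ℕ} (σ₁ σ₂ ν T : ℝ) (ρ₀ : Space d → ℝ) (ρ : ℝ → L2 d) : Prop where
  initial : ρ 0 =ᵐ[volume] ρ₀
  bounded : BoundedL1Linf T ρ
  continuous : ContinuousOn ρ (Icc 0 T)
  timeDeriv : ∃ g : ℝ → HNeg1 d, MemLp g 2 (volume.restrict (Ioo 0 T)) ∧ IsTimeDerivative T ρ g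
  sobolev : 0 < ν → ∃ u : ℝ → H1 d, MemLp u 2 (volume.restrict (Ioo 0 T)) ∧
    ∀ᵐ t ∂(volume.restrict (Ioo 0 T)), toL2 (u t) = ρ t
  weakForm : ∀ φ : ℝ × Space d → ℝ, ContDiff ℝ ∞ φ → HasCompactSupport φ →
    tsupport φ ⊆ Iio T ×ˢ univ →
    (∫ t in Ioo 0 T, ∫ x,
      (ρ t x * deriv (fun s => φ (s, x)) t
        + ρ t x * ⟪velocity σ₁ (ρ t) x, gradient (fun y => φ (t, y)) x⟫
        + (σ₁ + σ₂) * (ρ t x) ^ 2 * φ (t, x)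
        - ν * ⟪weakGrad (ρ t) x, gradient (fun y => φ (t, y)) x⟫))
      + ∫ x, ρ₀ x * φ (0, x) = 0

end GAG

end

noncomputable section

namespace GAG

variable {d : ℕ}

/-! ### The Newtonian kernel -/

/-! Testing the equation with `aR a R` as a function of space gives, in integrated form, the
evolution of `∫ ρ(t) a_R`: a flux term `∫ ρ v · ∇a_R`, a source term `(σ₁ + σ₂) ∫ ρ² a_R`, and a
diffusive term `ν ∫ ρ Δa_R`. The density is bounded in `L¹ ∩ L^∞`, and `∇Φ` is `O(|x|^{1-d})`, so
the velocity is bounded uniformly in space and time. Since `∇a_R` is `O(1/R)` and `Δa_R` is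
`O(1/R²)`, the `L¹` bound makes flux and diffusion vanish as `R → ∞`. Dominated convergence in space
and time leaves the mass identity.

Two points need work. The equation holds only weakly in time, so the integrated form is obtained
from `eq_add_integral_of_weak`, which asks for a right-hand side continuous in time. For the flux
this rests on `exists_lintegral_kernel_le`: the velocity depends continuously on the density,
uniformly in `x`, when the density moves in `L²` within a bounded set of `L¹ ∩ L^∞`. Moreover the
`L¹` and `L^∞` bounds are given only for almost every time; `BoundedL1Linf.exists_boundedOn` extends
them to all of `[0, T]`.

The conservation criterion follows because `∫₀ᵀ ‖ρ‖²` is positive for a nonzero continuous path. -/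

theorem norm_gradient_eq (f : Space d → ℝ) (x : Space d) : ‖gradient f x‖ = ‖fderiv ℝ f x‖ := by
  simp [gradient]

theorem measurable_gradient (f : Space d → ℝ) : Measurable (gradient f) :=
  (InnerProductSpace.toDual ℝ (Space d)).symm.continuous.measurable.comp (measurable_fderiv ℝ f)

/-- The derivative of a radial function is bounded by the derivative of its profile. -/
theorem norm_fderiv_comp_norm_le {g : ℝ → ℝ} {g' : ℝ} {x : Space d} (hx : x ≠ 0)
    (hg : HasDerivAt g g' ‖x‖) : ‖fderiv ℝ (fun y : Space d => g ‖y‖) x‖ ≤ |g'| := by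
  have h1 : HasFDerivAt (fun y : Space d => ‖y‖) (fderiv ℝ (fun y : Space d => ‖y‖) x) x :=
    ((contDiffAt_norm ℝ hx).differentiableAt (n := 1) one_ne_zero).hasFDerivAt
  have h2 : HasFDerivAt (fun y : Space d => g ‖y‖) (g' • fderiv ℝ (fun y : Space d => ‖y‖) x) x :=
    hg.comp_hasFDerivAt x h1
  have h3 : ‖fderiv ℝ (fun y : Space d => ‖y‖) x‖ ≤ 1 := by
    simpa using norm_fderiv_le_of_lipschitz ℝ (x₀ := x) (lipschitzWith_one_norm (E := Space d))
  rw [h2.fderiv, norm_smul, Real.norm_eq_abs]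
  exact mul_le_of_le_one_right (abs_nonneg _) h3

-- The order `d - 1` of the singularity lies strictly between `0` and `d`: the kernel is locally
-- integrable and decays at infinity. Nothing else about `Φ` enters the estimates.
variable (d) in
theorem exists_norm_gradient_newtonian_le :
    ∃ C : ℝ, 0 ≤ C ∧ ∀ x : Space d, x ≠ 0 →
      ‖gradient (newtonian d) x‖ ≤ C * ‖x‖ ^ (-((d : ℝ) - 1)) := by
  by_cases hd : d = 2
  · subst hd
    refine ⟨(2 * Real.pi)⁻¹, by positivity, fun x hx => ?_⟩
    have hx' : ‖x‖ ≠ 0 := norm_ne_zero_iff.mpr hx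
    have h := norm_fderiv_comp_norm_le hx ((Real.hasDerivAt_log hx').const_mul (2 * Real.pi)⁻¹)
    have e : newtonian 2 = fun y : Space 2 => (2 * Real.pi)⁻¹ * Real.log ‖y‖ := by
      funext y; simp [newtonian]
    rw [norm_gradient_eq, e]
    refine h.trans (le_of_eq ?_)
    rw [abs_of_nonneg (by positivity), show -(((2 : ℕ) : ℝ) - 1) = -1 by norm_num,
      Real.rpow_neg_one]
  · refine ⟨|-(((d : ℝ) - 2) * sphereArea d)⁻¹| * |2 - (d : ℝ)|, by positivity, fun x hx => ?_⟩
    have hx' : ‖x‖ ≠ 0 := norm_ne_zero_iff.mpr hx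
    have h := norm_fderiv_comp_norm_le hx
      ((Real.hasDerivAt_rpow_const (p := 2 - (d : ℝ)) (Or.inl hx')).const_mul
        (-(((d : ℝ) - 2) * sphereArea d)⁻¹))
    have e : newtonian d =
        fun y : Space d => -(((d : ℝ) - 2) * sphereArea d)⁻¹ * ‖y‖ ^ (2 - (d : ℝ)) := by
      funext y; simp [newtonian, hd]
    rw [norm_gradient_eq, e]
    refine h.trans (le_of_eq ?_)
    rw [abs_mul, abs_mul, abs_of_nonneg (Real.rpow_nonneg (norm_nonneg x) _), mul_assoc,
      show 2 - (d : ℝ) - 1 = -((d : ℝ) - 1) by ring]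

/-! ### Convolution with a weakly singular kernel -/

theorem setLIntegral_enorm_le_eLpNorm_two {f : Space d → ℝ} (hf : AEStronglyMeasurable f volume)
    (S : Set (Space d)) :
    ∫⁻ y in S, ‖f y‖ₑ ≤ eLpNorm f 2 volume * volume S ^ (1 / 2 : ℝ) := by
  have h := eLpNorm_le_eLpNorm_mul_rpow_measure_univ (p := 1) (q := 2) (by norm_num)
    (hf.restrict (s := S))
  rw [eLpNorm_one_eq_lintegral_enorm, Measure.restrict_apply_univ] at h
  refine h.trans ?_
  have : (1 / (1 : ℝ≥0∞).toReal - 1 / (2 : ℝ≥0∞).toReal) = (1 / 2 : ℝ) := by norm_num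
  rw [this]
  gcongr
  exact Measure.restrict_le_self

/-- The kernel is cut into three zones. Near the origin its `L¹` norm is at most `δ`, paired with
the `L^∞` norm of `f`; far away its size is at most `δ`, paired with the `L¹` norm; in between it is
bounded, and Cauchy–Schwarz on a ball of radius `r` gives the `L²` norm. The radii depend only on
`K` and `δ`, so `c` serves all `f` and `x`. -/
theorem exists_lintegral_kernel_le {F : Type*} [NormedAddCommGroup F] (hd : 1 ≤ d)
    {K : Space d → F} (hK : AEStronglyMeasurable K volume) {C α : ℝ} (hα : 0 < α) (hαd : α < d)
    (hC : 0 ≤ C) (hKle : ∀ z, z ≠ 0 → ‖K z‖ ≤ C * ‖z‖ ^ (-α)) {δ : ℝ≥0} (hδ : 0 < δ) :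
    ∃ c : ℝ≥0, ∀ f : Space d → ℝ, AEStronglyMeasurable f volume → ∀ x,
      ∫⁻ y, ‖f y‖ₑ * ‖K (x - y)‖ₑ ≤
        δ * (eLpNorm f 1 volume + eLpNorm f ∞ volume) + c * eLpNorm f 2 volume := by
  have : Nonempty (Fin d) := ⟨⟨0, hd⟩⟩
  have hfin : Module.finrank ℝ (Space d) = d := by simp
  have hae : ∀ᵐ z : Space d, z ≠ 0 := by
    simp [ae_iff, measure_singleton]
  have hint : IntegrableOn K (Metric.ball 0 1) volume :=
    integrableOn_ball_of_norm_le_rpow (by rw [hfin]; exact hd) (by rw [hfin]; exact hαd)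
      (ae_restrict_of_ae (hae.mono fun z hz => hKle z hz)) hK
  obtain ⟨ε, hε, hε1, hnear⟩ : ∃ ε : ℝ, 0 < ε ∧ ε < 1 ∧
      ∫⁻ z in Metric.ball 0 ε, ‖K z‖ₑ ≤ (δ : ℝ≥0∞) := by
    -- Absolute continuity of the integral of `‖K‖` over the unit ball; small balls have small
    -- measure.
    obtain ⟨η, hη, h⟩ := exists_pos_setLIntegral_lt_of_measure_lt
      (μ := volume.restrict (Metric.ball (0 : Space d) 1)) hint.2.ne
      (ε := (δ : ℝ≥0∞)) (by exact_mod_cast hδ.ne')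
    have ht : Tendsto (fun r : ℝ => volume (Metric.ball (0 : Space d) r)) (𝓝[>] 0) (𝓝 0) := by
      have h1 : ∀ r ∈ Ioi (0 : ℝ), volume (Metric.ball (0 : Space d) r)
          = ENNReal.ofReal (r ^ d) * volume (Metric.ball (0 : Space d) 1) := fun r hr => by
        rw [Measure.addHaar_ball_of_pos _ _ hr, hfin]
      refine Tendsto.congr' (f₁ := fun r : ℝ =>
        ENNReal.ofReal (r ^ d) * volume (Metric.ball (0 : Space d) 1))
        (eventually_mem_nhdsWithin.mono fun r hr => (h1 r hr).symm) ?_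
      have h2 : Tendsto (fun r : ℝ => ENNReal.ofReal (r ^ d)) (𝓝 0) (𝓝 0) := by
        have : Continuous fun r : ℝ => ENNReal.ofReal (r ^ d) :=
        ENNReal.continuous_ofReal.comp (continuous_pow d)
        simpa [show d ≠ 0 by omega] using this.tendsto 0
      simpa using ENNReal.Tendsto.mul_const (h2.mono_left nhdsWithin_le_nhds)
        (Or.inr measure_ball_lt_top.ne)
    obtain ⟨ε, hε, hε0, hε1⟩ := ((ht.eventually_lt_const hη).and
      (Ioo_mem_nhdsGT (show (0 : ℝ) < 1 by norm_num))).exists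
    refine ⟨ε, hε0, hε1, ?_⟩
    have := h (Metric.ball 0 ε) ((Measure.restrict_apply_le _ _).trans_lt hε)
    rw [Measure.restrict_restrict Metric.isOpen_ball.measurableSet,
      inter_eq_left.mpr (Metric.ball_subset_ball hε1.le)] at this
    exact this.le
  obtain ⟨r, hr, hr0⟩ : ∃ r : ℝ, C * r ^ (-α) ≤ δ ∧ 0 < r := by
    have h1 : Tendsto (fun r : ℝ => C * r ^ (-α)) atTop (𝓝 0) := by
      simpa using (tendsto_rpow_neg_atTop hα).const_mul C
    exact ((h1.eventually_le_const (by exact_mod_cast hδ)).and (eventually_gt_atTop 0)).exists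
  set c₀ : ℝ≥0 := Real.toNNReal (C * ε ^ (-α)) with hc₀
  refine ⟨c₀ * (volume (Metric.ball (0 : Space d) r) ^ (1 / 2 : ℝ)).toNNReal, fun f hf x => ?_⟩
  -- The middle term is supported on the whole ball of radius `r`: overlapping the inner zone costs
  -- nothing, and no order between `ε` and `r` is needed.
  have hsplit : ∀ z, ‖K z‖ₑ ≤ (Metric.ball 0 ε).indicator (fun z => ‖K z‖ₑ) z
      + (Metric.ball 0 r).indicator (fun _ => (c₀ : ℝ≥0∞)) z + δ := by
    intro z
    by_cases h1 : z ∈ Metric.ball (0 : Space d) ε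
    · rw [indicator_of_mem h1, add_assoc]; exact le_self_add
    have hz : ε ≤ ‖z‖ := by simpa using h1
    have hz0 : z ≠ 0 := norm_pos_iff.mp (hε.trans_le hz)
    by_cases h2 : z ∈ Metric.ball (0 : Space d) r
    · rw [indicator_of_mem h2]
      refine le_trans ?_ (le_trans le_add_self le_self_add)
      rw [← ofReal_norm, hc₀, ENNReal.ofReal]
      have := (hKle z hz0).trans (mul_le_mul_of_nonneg_left
        (Real.rpow_le_rpow_of_nonpos hε hz (by linarith)) hC)
      exact_mod_cast Real.toNNReal_le_toNNReal this
    · have hz' : r ≤ ‖z‖ := by simpa using h2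
      refine le_trans ?_ le_add_self
      rw [← ofReal_norm]
      have := ((hKle z hz0).trans (mul_le_mul_of_nonneg_left
        (Real.rpow_le_rpow_of_nonpos hr0 hz' (by linarith)) hC)).trans hr
      simpa using ENNReal.ofReal_le_ofReal this
  have hfm : AEMeasurable (fun y => ‖f y‖ₑ) volume := hf.enorm
  have hKx : AEMeasurable (fun y => (Metric.ball 0 ε).indicator (fun z => ‖K z‖ₑ) (x - y))
      volume :=
    (hK.enorm.indicator Metric.isOpen_ball.measurableSet).comp_quasiMeasurePreserving
      (quasiMeasurePreserving_sub_left volume x)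
  have hmid : AEMeasurable (fun y => ‖f y‖ₑ
      * (Metric.ball 0 r).indicator (fun _ => (c₀ : ℝ≥0∞)) (x - y)) volume :=
    hfm.mul ((measurable_const.indicator Metric.isOpen_ball.measurableSet).comp
      (measurable_id.const_sub x)).aemeasurable
  calc ∫⁻ y, ‖f y‖ₑ * ‖K (x - y)‖ₑ
      ≤ ∫⁻ y, (‖f y‖ₑ * (Metric.ball 0 ε).indicator (fun z => ‖K z‖ₑ) (x - y)
        + ‖f y‖ₑ * (Metric.ball 0 r).indicator (fun _ => (c₀ : ℝ≥0∞)) (x - y)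
        + ‖f y‖ₑ * δ) := by
        refine lintegral_mono fun y => ?_
        rw [← mul_add, ← mul_add]
        gcongr
        exact hsplit _
    _ = (∫⁻ y, ‖f y‖ₑ * (Metric.ball 0 ε).indicator (fun z => ‖K z‖ₑ) (x - y))
        + (∫⁻ y, ‖f y‖ₑ * (Metric.ball 0 r).indicator (fun _ => (c₀ : ℝ≥0∞)) (x - y))
        + ∫⁻ y, ‖f y‖ₑ * δ := by
        rw [lintegral_add_right' _ (hfm.mul_const _),
          lintegral_add_right' _ hmid]
    _ ≤ δ * eLpNorm f ∞ volume
        + c₀ * (eLpNorm f 2 volume * volume (Metric.ball (0 : Space d) r) ^ (1 / 2 : ℝ))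
        + δ * eLpNorm f 1 volume := by
        gcongr
        · calc _ ≤ ∫⁻ y, eLpNorm f ∞ volume
                  * (Metric.ball 0 ε).indicator (fun z => ‖K z‖ₑ) (x - y) := by
                refine lintegral_mono_ae ?_
                filter_upwards [enorm_ae_le_eLpNormEssSup f volume] with y hy
                rw [eLpNorm_exponent_top]
                gcongr
            _ = eLpNorm f ∞ volume
                  * ∫⁻ y, (Metric.ball 0 ε).indicator (fun z => ‖K z‖ₑ) (x - y) :=
                lintegral_const_mul'' _ hKx
            _ = eLpNorm f ∞ volume * ∫⁻ z in Metric.ball 0 ε, ‖K z‖ₑ := by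
                rw [lintegral_sub_left_eq_self
                  (fun z => (Metric.ball 0 ε).indicator (fun z => ‖K z‖ₑ) z) x,
                  lintegral_indicator Metric.isOpen_ball.measurableSet]
            _ ≤ _ := by rw [mul_comm]; gcongr
        · have e : ∀ y, ‖f y‖ₑ * (Metric.ball 0 r).indicator (fun _ => (c₀ : ℝ≥0∞)) (x - y)
              = c₀ * (Metric.ball x r).indicator (fun y => ‖f y‖ₑ) y := fun y => by
            by_cases hy : y ∈ Metric.ball x r
            · have hy' : x - y ∈ Metric.ball (0 : Space d) r := by
                rw [mem_ball_zero_iff, ← dist_eq_norm, dist_comm]; exact hy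
              rw [indicator_of_mem hy, indicator_of_mem hy', mul_comm]
            · have hy' : x - y ∉ Metric.ball (0 : Space d) r := by
                rw [mem_ball_zero_iff, ← dist_eq_norm, dist_comm]; exact hy
              rw [indicator_of_notMem hy, indicator_of_notMem hy', mul_zero, mul_zero]
          simp_rw [e]
          rw [lintegral_const_mul' _ _ ENNReal.coe_ne_top,
            lintegral_indicator Metric.isOpen_ball.measurableSet]
          gcongr
          refine (setLIntegral_enorm_le_eLpNorm_two hf _).trans ?_
          rw [Measure.addHaar_ball_center]
        · rw [lintegral_mul_const' _ _ ENNReal.coe_ne_top, eLpNorm_one_eq_lintegral_enorm,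
            mul_comm]
    _ = _ := by
        have h3 : volume (Metric.ball (0 : Space d) r) ^ (1 / 2 : ℝ) ≠ (⊤ : ℝ≥0∞) :=
          ENNReal.rpow_ne_top_of_nonneg (by norm_num) measure_ball_lt_top.ne
        rw [ENNReal.coe_mul, ENNReal.coe_toNNReal h3]
        ring

/-! ### The velocity field -/

theorem enorm_velocity_le (σ : ℝ) (f : Space d → ℝ) (x : Space d) :
    ‖velocity σ f x‖ₑ ≤ ‖σ‖ₑ * ∫⁻ y, ‖f y‖ₑ * ‖gradient (newtonian d) (x - y)‖ₑ := by
  rw [velocity, enorm_smul, convolution_def]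
  gcongr
  refine (enorm_integral_le_lintegral_enorm _).trans (le_of_eq ?_)
  simp [enorm_smul]

/-- Up to an arbitrarily small error, the velocity is controlled uniformly by the `L²` norm of the
density, on bounded sets of `L¹ ∩ L^∞`. -/
theorem exists_lintegral_gradient_newtonian_le (hd : 2 ≤ d) {δ : ℝ≥0} (hδ : 0 < δ) :
    ∃ c : ℝ≥0, ∀ f : Space d → ℝ, AEStronglyMeasurable f volume → ∀ x,
      ∫⁻ y, ‖f y‖ₑ * ‖gradient (newtonian d) (x - y)‖ₑ ≤
        δ * (eLpNorm f 1 volume + eLpNorm f ∞ volume) + c * eLpNorm f 2 volume := by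
  obtain ⟨C, hC, hle⟩ := exists_norm_gradient_newtonian_le d
  have hd' : (2 : ℝ) ≤ d := by exact_mod_cast hd
  exact exists_lintegral_kernel_le (by omega) (measurable_gradient _).aestronglyMeasurable
    (by linarith) (by linarith) hC hle hδ

theorem exists_enorm_velocity_le (hd : 2 ≤ d) (σ : ℝ) (M : ℝ≥0) {δ : ℝ≥0} (hδ : 0 < δ) :
    ∃ c : ℝ≥0, ∀ f : Space d → ℝ, AEStronglyMeasurable f volume → eLpNorm f 1 volume ≤ M →
      eLpNorm f ∞ volume ≤ M → ∀ x, ‖velocity σ f x‖ₑ ≤ δ + c * eLpNorm f 2 volume := by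
  obtain ⟨c, hc⟩ := exists_lintegral_gradient_newtonian_le hd
    -- The error is scaled so that, multiplied by `|σ|` and by the bound `M + M` of the two norms,
    -- it stays below `δ`; each `+ 1` keeps the denominator positive.
    (show 0 < δ / ((‖σ‖₊ + 1) * (M + M + 1)) by positivity)
  refine ⟨‖σ‖₊ * c, fun f hf h1 h2 x => (enorm_velocity_le σ f x).trans ?_⟩
  have h := hc f hf x
  calc _ ≤ ‖σ‖ₑ * ((δ / ((‖σ‖₊ + 1) * (M + M + 1)) : ℝ≥0) * ((M : ℝ≥0∞) + M)
        + c * eLpNorm f 2 volume) := by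
        gcongr
        exact h.trans (by gcongr)
    _ = ((‖σ‖₊ * (δ / ((‖σ‖₊ + 1) * (M + M + 1)) * (M + M)) : ℝ≥0) : ℝ≥0∞)
        + (‖σ‖₊ * c : ℝ≥0) * eLpNorm f 2 volume := by
        rw [enorm_eq_nnnorm]; push_cast; ring
    _ ≤ _ := by
        gcongr
        have e : ‖σ‖₊ * (δ / ((‖σ‖₊ + 1) * (M + M + 1)) * (M + M))
            = δ * ((‖σ‖₊ * (M + M)) / ((‖σ‖₊ + 1) * (M + M + 1))) := by ring
        rw [e]
        refine mul_le_of_le_one_right (by positivity) (div_le_one_of_le₀ ?_ (by positivity))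
        exact mul_le_mul' le_self_add le_self_add

theorem integrable_velocity_integrand (hd : 2 ≤ d) {f : Space d → ℝ} (h1 : MemLp f 1 volume)
    (h2 : MemLp f 2 volume) (h3 : MemLp f ∞ volume) (x : Space d) :
    ConvolutionExistsAt f (gradient (newtonian d)) x (ContinuousLinearMap.lsmul ℝ ℝ) volume := by
  obtain ⟨c, hc⟩ := exists_lintegral_gradient_newtonian_le hd zero_lt_one
  refine ⟨h1.1.convolution_integrand_snd _
    (measurable_gradient (newtonian d)).aestronglyMeasurable x, ?_⟩
  have e : ∀ y, ‖ContinuousLinearMap.lsmul ℝ ℝ (f y) (gradient (newtonian d) (x - y))‖ₑ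
      = ‖f y‖ₑ * ‖gradient (newtonian d) (x - y)‖ₑ := fun y => by simp [enorm_smul]
  rw [HasFiniteIntegral]
  simp_rw [e]
  refine (hc f h1.1 x).trans_lt ?_
  have := h1.2; have := h2.2; have := h3.2
  finiteness

theorem velocity_sub (hd : 2 ≤ d) (σ : ℝ) {f g : Space d → ℝ} (hf1 : MemLp f 1 volume)
    (hf2 : MemLp f 2 volume) (hf3 : MemLp f ∞ volume) (hg1 : MemLp g 1 volume)
    (hg2 : MemLp g 2 volume) (hg3 : MemLp g ∞ volume) (x : Space d) :
    velocity σ (f - g) x = velocity σ f x - velocity σ g x := by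
  have h := integral_sub (integrable_velocity_integrand hd hf1 hf2 hf3 x)
    (integrable_velocity_integrand hd hg1 hg2 hg3 x)
  simp only [velocity, convolution_def]
  rw [← smul_sub, ← h]
  simp

theorem aestronglyMeasurable_velocity (σ : ℝ) {f : Space d → ℝ}
    (hf : AEStronglyMeasurable f volume) : AEStronglyMeasurable (velocity σ f) volume := by
  have h := (hf.convolution_integrand (μ := volume) (ContinuousLinearMap.lsmul ℝ ℝ)
    (measurable_gradient (newtonian d)).aestronglyMeasurable).integral_prod_right'
  exact h.const_smul σ

/-! ### Paths in `L²` that are bounded in `L¹ ∩ L^∞` -/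

theorem integral_mul_eq_inner (f : L2 d) {g : Space d → ℝ} (hg : MemLp g 2 volume) :
    ∫ x, f x * g x = ⟪f, hg.toLp g⟫ := by
  rw [L2.inner_def]
  refine integral_congr_ae ?_
  filter_upwards [hg.coeFn_toLp] with x hx
  rw [hx]
  simp [mul_comm]

theorem continuousOn_integral_mul {S : Set ℝ} {ρ : ℝ → L2 d} (hρ : ContinuousOn ρ S)
    {g : ℝ → Space d → ℝ} (hg : ∀ t ∈ S, MemLp (g t) 2 volume)
    (hgc : ∀ t ∈ S, ∀ ε : ℝ≥0∞, 0 < ε → ∀ᶠ s in 𝓝[S] t, eLpNorm (g s - g t) 2 volume < ε) :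
    ContinuousOn (fun t => ∫ x, ρ t x * g t x) S := by
  classical
  -- The value `0` off `S` never matters; it only makes `q` total.
  let q : ℝ → L2 d := fun t => if ht : t ∈ S then (hg t ht).toLp _ else 0
  have hq : ContinuousOn q S := fun t ht => by
    refine EMetric.tendsto_nhds.mpr fun ε hε => ?_
    filter_upwards [hgc t ht ε hε, self_mem_nhdsWithin] with s hs1 hs
    simp only [q, dif_pos hs, dif_pos ht]
    rwa [Lp.edist_toLp_toLp]
  refine (hρ.inner hq (𝕜 := ℝ)).congr fun t ht => ?_
  simp only [q, dif_pos ht]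
  exact integral_mul_eq_inner _ _

theorem continuousOn_integral_mul_const {S : Set ℝ} {ρ : ℝ → L2 d} (hρ : ContinuousOn ρ S)
    {w : Space d → ℝ} (hw : MemLp w 2 volume) :
    ContinuousOn (fun t => ∫ x, ρ t x * w x) S :=
  continuousOn_integral_mul hρ (fun _ _ => hw) fun t _ ε hε =>
    Eventually.of_forall fun s => by simpa using hε

theorem memLp_mul_bounded (f : L2 d) {w : Space d → ℝ} (hw : AEStronglyMeasurable w volume)
    {W : ℝ} (hW : ∀ x, ‖w x‖ ≤ W) : MemLp (fun x => f x * w x) 2 volume := by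
  refine (Lp.memLp f).of_le_mul (c := W) ((Lp.aestronglyMeasurable f).mul hw)
    (Eventually.of_forall fun x => ?_)
  rw [norm_mul, mul_comm]
  gcongr
  exact hW x

theorem continuousOn_integral_mul_mul {S : Set ℝ} {ρ : ℝ → L2 d} (hρ : ContinuousOn ρ S)
    {w : Space d → ℝ} (hw : AEStronglyMeasurable w volume) {W : ℝ≥0} (hW : ∀ x, ‖w x‖ ≤ W) :
    ContinuousOn (fun t => ∫ x, ρ t x * (ρ t x * w x)) S := by
  refine continuousOn_integral_mul hρ (fun t _ => memLp_mul_bounded (ρ t) hw hW)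
    fun t ht ε hε => ?_
  have h1 : Tendsto (fun s => (W : ℝ≥0∞) * edist (ρ s) (ρ t)) (𝓝[S] t) (𝓝 0) := by
    simpa using ENNReal.Tendsto.const_mul (tendsto_iff_edist_tendsto_0.mp (hρ t ht))
      (a := (W : ℝ≥0∞)) (Or.inr ENNReal.coe_ne_top)
  filter_upwards [h1.eventually_lt_const hε] with s hs
  refine lt_of_le_of_lt ?_ hs
  rw [Lp.edist_def]
  refine eLpNorm_le_mul_eLpNorm_of_ae_le_mul' (Eventually.of_forall fun x => ?_) 2
  rw [Pi.sub_apply, Pi.sub_apply, ← sub_mul, enorm_mul, mul_comm]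
  gcongr
  exact enorm_le_coe.mpr (hW x)

/-- Pointwise bounds in `L¹` and `L^∞` on a set of times. -/
def BoundedOn (S : Set ℝ) (ρ : ℝ → L2 d) (M : ℝ≥0) : Prop :=
  ∀ t ∈ S, eLpNorm (ρ t) 1 volume ≤ M ∧ eLpNorm (ρ t) ∞ volume ≤ M

namespace BoundedOn

variable {S : Set ℝ} {ρ : ℝ → L2 d} {M : ℝ≥0} {t : ℝ}

theorem memLp_one (h : BoundedOn S ρ M) (ht : t ∈ S) : MemLp (ρ t) 1 volume :=
  ⟨Lp.aestronglyMeasurable _, (h t ht).1.trans_lt ENNReal.coe_lt_top⟩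

theorem memLp_top (h : BoundedOn S ρ M) (ht : t ∈ S) : MemLp (ρ t) ∞ volume :=
  ⟨Lp.aestronglyMeasurable _, (h t ht).2.trans_lt ENNReal.coe_lt_top⟩

theorem integrable (h : BoundedOn S ρ M) (ht : t ∈ S) : Integrable (ρ t) volume :=
  memLp_one_iff_integrable.mp (h.memLp_one ht)

theorem integral_norm_le (h : BoundedOn S ρ M) (ht : t ∈ S) : ∫ x, ‖ρ t x‖ ≤ M := by
  rw [integral_norm_eq_lintegral_enorm (Lp.aestronglyMeasurable _),
    ← eLpNorm_one_eq_lintegral_enorm]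
  exact ENNReal.toReal_le_coe_of_le_coe (h t ht).1

/-- The velocity is linear in the density, and the difference of two densities is bounded by `2M` in
`L¹` and in `L^∞`. -/
theorem exists_velocity_sub_le (hd : 2 ≤ d) (σ : ℝ) (h : BoundedOn S ρ M) {δ : ℝ≥0}
    (hδ : 0 < δ) : ∃ c : ℝ≥0, ∀ s ∈ S, ∀ t ∈ S, ∀ x,
      ‖velocity σ (ρ s) x - velocity σ (ρ t) x‖ₑ ≤ δ + c * edist (ρ s) (ρ t) := by
  obtain ⟨c, hc⟩ := exists_enorm_velocity_le hd σ (M + M) hδ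
  refine ⟨c, fun s hs t ht x => ?_⟩
  rw [← velocity_sub hd σ (h.memLp_one hs) (Lp.memLp _) (h.memLp_top hs) (h.memLp_one ht)
    (Lp.memLp _) (h.memLp_top ht), Lp.edist_def]
  refine hc _ ((Lp.aestronglyMeasurable _).sub (Lp.aestronglyMeasurable _)) ?_ ?_ x
  · refine (eLpNorm_sub_le (Lp.aestronglyMeasurable _) (Lp.aestronglyMeasurable _) le_rfl).trans ?_
    push_cast
    exact add_le_add (h s hs).1 (h t ht).1
  · refine (eLpNorm_sub_le (Lp.aestronglyMeasurable _) (Lp.aestronglyMeasurable _) le_top).trans ?_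
    push_cast
    exact add_le_add (h s hs).2 (h t ht).2

theorem exists_velocity_le (hd : 2 ≤ d) (σ : ℝ) (h : BoundedOn S ρ M) (hS : IsCompact S)
    (hρ : ContinuousOn ρ S) : ∃ V : ℝ, 0 ≤ V ∧ ∀ t ∈ S, ∀ x, ‖velocity σ (ρ t) x‖ ≤ V := by
  obtain ⟨c, hc⟩ := exists_enorm_velocity_le hd σ M zero_lt_one
  obtain ⟨B, hB⟩ := hS.exists_bound_of_continuousOn hρ
  refine ⟨1 + c * max B 0, by positivity, fun t ht x => ?_⟩
  have h1 := hc _ (Lp.aestronglyMeasurable _) (h t ht).1 (h t ht).2 x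
  rw [← Lp.enorm_def, ← ofReal_norm, ← ofReal_norm, ← ENNReal.ofReal_coe_nnreal,
    ← ENNReal.ofReal_coe_nnreal, ← ENNReal.ofReal_mul c.coe_nonneg,
    ← ENNReal.ofReal_add (by positivity) (by positivity),
    ENNReal.ofReal_le_ofReal_iff (by positivity)] at h1
  refine h1.trans ?_
  gcongr
  · simp
  · exact (hB t ht).trans (le_max_left _ _)

theorem memLp_inner_velocity (hd : 2 ≤ d) (σ : ℝ) (h : BoundedOn S ρ M) (ht : t ∈ S)
    {w : Space d → Space d} (hw : MemLp w 2 volume) :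
    MemLp (fun x => ⟪velocity σ (ρ t) x, w x⟫) 2 volume := by
  -- Only one time is involved, so the compact set is taken to be a singleton.
  obtain ⟨V, -, hV⟩ := BoundedOn.exists_velocity_le (S := {t}) hd σ
    (fun s hs => by rw [mem_singleton_iff.mp hs]; exact h t ht) isCompact_singleton
    (continuousOn_singleton ρ t)
  refine hw.of_le_mul (c := V)
    ((aestronglyMeasurable_velocity σ (Lp.aestronglyMeasurable _)).inner hw.1) ?_
  refine Eventually.of_forall fun x => (norm_inner_le_norm _ _).trans ?_
  gcongr
  exact hV t rfl x

theorem continuousOn_integral_flux (hd : 2 ≤ d) (σ : ℝ) (h : BoundedOn S ρ M)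
    (hρ : ContinuousOn ρ S) {w : Space d → Space d} (hw : MemLp w 2 volume) :
    ContinuousOn (fun t => ∫ x, ρ t x * ⟪velocity σ (ρ t) x, w x⟫) S := by
  refine continuousOn_integral_mul hρ (fun t ht => h.memLp_inner_velocity hd σ ht hw)
    fun t ht ε hε => ?_
  -- `δ` absorbs the part of the velocity estimate that does not tend to zero; the remainder `c *
  -- edist (ρ s) (ρ t)` does.
  obtain ⟨δ, hδ, hδε⟩ := ENNReal.exists_nnreal_pos_mul_lt hw.2.ne hε.ne'
  obtain ⟨c, hc⟩ := h.exists_velocity_sub_le hd σ hδ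
  have hlim : Tendsto (fun s => ((δ : ℝ≥0∞) + c * edist (ρ s) (ρ t)) * eLpNorm w 2 volume)
      (𝓝[S] t) (𝓝 (δ * eLpNorm w 2 volume)) := by
    have h1 : Tendsto (fun s => edist (ρ s) (ρ t)) (𝓝[S] t) (𝓝 0) :=
      tendsto_iff_edist_tendsto_0.mp (hρ t ht)
    have h2 := ENNReal.Tendsto.const_mul h1 (a := (c : ℝ≥0∞)) (Or.inr ENNReal.coe_ne_top)
    have h3 := ENNReal.Tendsto.mul_const (tendsto_const_nhds (x := (δ : ℝ≥0∞)).add h2)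
      (b := eLpNorm w 2 volume) (Or.inr hw.2.ne)
    simpa using h3
  filter_upwards [hlim.eventually_lt_const hδε, self_mem_nhdsWithin] with s hs1 hs
  refine lt_of_le_of_lt ?_ hs1
  refine eLpNorm_le_mul_eLpNorm_of_ae_le_mul'' 2 hw.1 (Eventually.of_forall fun x => ?_)
  rw [Pi.sub_apply, ← inner_sub_left]
  calc _ ≤ ‖velocity σ (ρ s) x - velocity σ (ρ t) x‖ₑ * ‖w x‖ₑ := by
        simp only [← ofReal_norm, ← ENNReal.ofReal_mul (norm_nonneg _)]
        exact ENNReal.ofReal_le_ofReal (norm_inner_le_norm _ _)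
    _ ≤ _ := by gcongr; exact hc s hs t ht x

end BoundedOn

/-- Bounds in `L¹` and `L^∞` that hold for almost every time hold for every time, if the path is
continuous in `L²`. -/
theorem BoundedL1Linf.exists_boundedOn {T : ℝ} (hT : 0 < T) {ρ : ℝ → L2 d}
    (h : BoundedL1Linf T ρ) (hρ : ContinuousOn ρ (Icc 0 T)) :
    ∃ M : ℝ≥0, BoundedOn (Icc 0 T) ρ M := by
  obtain ⟨M, hM⟩ := h
  refine ⟨M, fun t ht => ?_⟩
  have hdense : ∃ s : ℕ → ℝ, (∀ n, s n ∈ Icc 0 T ∧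
      eLpNorm (ρ (s n)) 1 volume + eLpNorm (ρ (s n)) ∞ volume ≤ M) ∧
      Tendsto s atTop (𝓝 t) := by
    -- A set of full measure is dense in `(0, T)`, hence its closure contains the endpoints too.
    -- Along good times tending to `t`, a subsequence converges almost everywhere, and both norms
    -- are lower semicontinuous under such limits.
    have hcl : t ∈ closure {s | s ∈ Icc 0 T ∧
        eLpNorm (ρ s) 1 volume + eLpNorm (ρ s) ∞ volume ≤ M} := by
      rw [ae_restrict_iff' measurableSet_Ioo] at hM
      have h1 : t ∈ closure (Ioo 0 T) := by rwa [closure_Ioo hT.ne]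
      have h2 := (Measure.dense_of_ae hM).open_subset_closure_inter (isOpen_Ioo (a := 0) (b := T))
      refine closure_minimal (h2.trans (closure_mono ?_)) isClosed_closure h1
      exact fun s hs => ⟨Ioo_subset_Icc_self hs.1, hs.2 hs.1⟩
    obtain ⟨s, hs, hst⟩ := mem_closure_iff_seq_limit.mp hcl
    exact ⟨s, hs, hst⟩
  obtain ⟨s, hs, hst⟩ := hdense
  have hlim : Tendsto (fun n => ρ (s n)) atTop (𝓝 (ρ t)) :=
    (hρ t ht).tendsto.comp (tendsto_nhdsWithin_iff.mpr ⟨hst, Eventually.of_forall fun n => (hs n).1⟩)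
  obtain ⟨ns, -, hns⟩ := (tendstoInMeasure_of_tendsto_Lp hlim).exists_seq_tendsto_ae
  exact ⟨Lp.eLpNorm_le_of_ae_tendsto (Eventually.of_forall fun n =>
      le_self_add.trans (hs (ns n)).2) (fun n => Lp.aestronglyMeasurable _) hns,
    Lp.eLpNorm_le_of_ae_tendsto (Eventually.of_forall fun n =>
      le_add_self.trans (hs (ns n)).2) (fun n => Lp.aestronglyMeasurable _) hns⟩

/-! ### From the weak to the integrated form of an ordinary differential equation -/

theorem hasDerivAt_primitive_to {ψ : ℝ → ℝ} (hψ : Continuous ψ) (T t : ℝ) :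
    HasDerivAt (fun t => ∫ s in t..T, ψ s) (-ψ t) t :=
  intervalIntegral.integral_hasDerivAt_left (hψ.intervalIntegrable _ _)
    (hψ.stronglyMeasurableAtFilter _ _) hψ.continuousAt

theorem contDiff_primitive_to {ψ : ℝ → ℝ} (hψ : ContDiff ℝ ∞ ψ) (T : ℝ) :
    ContDiff ℝ ∞ (fun t => ∫ s in t..T, ψ s) := by
  rw [contDiff_infty_iff_deriv]
  refine ⟨fun t => (hasDerivAt_primitive_to hψ.continuous T t).differentiableAt, ?_⟩
  rw [show deriv (fun t => ∫ s in t..T, ψ s) = fun t => -ψ t from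
    funext fun t => (hasDerivAt_primitive_to hψ.continuous T t).deriv]
  exact hψ.neg

/-- The defect `D` is orthogonal to every test function `ψ` on `(0, T)`: take for `η` the primitive
`P(t) = ∫ₜᵀ ψ`. It vanishes near `T` but not necessarily at `0`, where `P(0) = ∫ ψ` produces the
term with `A 0`. -/
theorem eq_add_integral_of_weak_of_continuous {T : ℝ} (hT : 0 < T) {A B : ℝ → ℝ}
    (hA : Continuous A) (hB : Continuous B)
    (h : ∀ η : ℝ → ℝ, ContDiff ℝ ∞ η → HasCompactSupport η → tsupport η ⊆ Iio T →
      (∫ t in Ioo 0 T, (deriv η t * A t + η t * B t)) + η 0 * A 0 = 0) :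
    ∀ t ∈ Icc 0 T, A t = A 0 + ∫ s in (0 : ℝ)..t, B s := by
  set D : ℝ → ℝ := fun t => A t - (A 0 + ∫ s in (0 : ℝ)..t, B s) with hD
  have hF : ∀ t, HasDerivAt (fun t => ∫ s in (0 : ℝ)..t, B s) (B t) t := fun t =>
    intervalIntegral.integral_hasDerivAt_right (hB.intervalIntegrable _ _)
      (hB.stronglyMeasurableAtFilter _ _) hB.continuousAt
  have hFc : Continuous (fun t => ∫ s in (0 : ℝ)..t, B s) :=
    continuous_iff_continuousAt.mpr fun t => (hF t).continuousAt
  have hDc : Continuous D := hA.sub (continuous_const.add hFc)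
  have hzero : ∀ᵐ t : ℝ, t ∈ Ioo 0 T → D t = 0 := by
    refine isOpen_Ioo.ae_eq_zero_of_integral_contDiff_smul_eq_zero
      (hDc.locallyIntegrable.locallyIntegrableOn _) fun ψ hψ hψc hψs => ?_
    have hψT : ∃ b < T, ∀ t, b ≤ t → ψ t = 0 := by
      rcases (tsupport ψ).eq_empty_or_nonempty with he | hne
      · exact ⟨T - 1, by linarith, fun t _ => by
          rw [tsupport_eq_empty_iff.mp he]; rfl⟩
      · obtain ⟨m, hm, hmax⟩ := hψc.isCompact.exists_isGreatest hne
        refine ⟨(m + T) / 2, by linarith [(hψs hm).2], fun t ht => ?_⟩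
        by_contra h0
        have := hmax (subset_tsupport ψ h0)
        linarith [(hψs hm).2]
    obtain ⟨b, hbT, hb⟩ := hψT
    -- `P` is constant on the left of the support of `ψ`, hence not compactly supported in general.
    -- The bump equals `1` on `[-T, T]` and cuts it off without altering it on `[0, T]`.
    let χ : ContDiffBump (0 : ℝ) := ⟨T, T + 1, hT, by linarith⟩
    set P : ℝ → ℝ := fun t => ∫ s in t..T, ψ s with hP
    have hPd := hasDerivAt_primitive_to hψ.continuous T
    have hPb : ∀ t, b ≤ t → P t = 0 := fun t ht => by
      rw [hP]
      refine (intervalIntegral.integral_congr (g := fun _ => 0) fun s hs => ?_).trans (by simp)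
      exact hb s ((le_min ht hbT.le).trans hs.1)
    have hχ : ∀ t ∈ Ioo 0 T, (fun t => χ t * P t) =ᶠ[𝓝 t] P := fun t ht => by
      filter_upwards [isOpen_Ioo.mem_nhds ht] with s hs
      rw [χ.one_of_mem_closedBall, one_mul]
      rw [mem_closedBall_zero_iff, Real.norm_eq_abs, abs_of_pos hs.1]
      exact hs.2.le
    have hw := h (fun t => χ t * P t) (χ.contDiff.mul (contDiff_primitive_to hψ T))
      (χ.hasCompactSupport.mul_right) (by
        refine (closure_minimal (t := Iic b) (fun t ht => ?_) isClosed_Iic).trans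
          fun t ht => lt_of_le_of_lt ht hbT
        by_contra h0
        exact ht (by simp [hPb t (not_le.mp h0).le]))
    have e1 : ∫ t in Ioo 0 T, (deriv (fun t => χ t * P t) t * A t + χ t * P t * B t)
        = ∫ t in (0 : ℝ)..T, (-(ψ t * A t) + P t * B t) := by
      rw [intervalIntegral.integral_of_le hT.le, integral_Ioc_eq_integral_Ioo]
      refine setIntegral_congr_fun measurableSet_Ioo fun t ht => ?_
      have e := (hχ t ht).deriv_eq.trans (hPd t).deriv
      have e' : χ t * P t = P t := (hχ t ht).self_of_nhds
      simp only [e, e']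
      ring
    have e2 : χ 0 = 1 := χ.one_of_mem_closedBall (by simp [hT.le, χ])
    have hPc : Continuous P := (contDiff_primitive_to hψ T).continuous
    -- Both boundary terms vanish: `P` is zero at `T`, the primitive of `B` is zero at `0`.
    have e3 := intervalIntegral.integral_mul_deriv_eq_deriv_mul (a := 0) (b := T)
      (fun t _ => hPd t) (fun t _ => hF t) (hψ.continuous.neg.intervalIntegrable _ _)
      (hB.intervalIntegrable _ _)
    have e4 : P T = 0 := by simp [hP]
    have ii : ∀ g : ℝ → ℝ, Continuous g → IntervalIntegrable g volume 0 T :=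
      fun g hg => hg.intervalIntegrable _ _
    have hψA : Continuous fun t => ψ t * A t := hψ.continuous.mul hA
    have hψ0 : Continuous fun t => ψ t * A 0 := hψ.continuous.mul continuous_const
    have hψF : Continuous fun t => ψ t * ∫ s in (0 : ℝ)..t, B s := hψ.continuous.mul hFc
    have hPB : Continuous fun t => P t * B t := hPc.mul hB
    rw [e1, e2, intervalIntegral.integral_add (ii (fun t => -(ψ t * A t)) hψA.neg) (ii _ hPB),
      e3] at hw
    simp only [intervalIntegral.integral_same, neg_mul, intervalIntegral.integral_neg] at hw
    have e5 : ∫ t, ψ t • D t = ∫ t in (0 : ℝ)..T, ψ t * D t := by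
      rw [intervalIntegral.integral_of_le hT.le, integral_Ioc_eq_integral_Ioo,
        setIntegral_eq_integral_of_forall_compl_eq_zero]
      · rfl
      · intro t ht
        have : ψ t = 0 := by
          by_contra h0
          exact ht (hψs (subset_tsupport ψ h0))
        rw [this, zero_mul]
    have e6 : ∫ t in (0 : ℝ)..T, ψ t * D t = (∫ t in (0 : ℝ)..T, ψ t * A t)
        - ((∫ t in (0 : ℝ)..T, ψ t * A 0) + ∫ t in (0 : ℝ)..T, ψ t * ∫ s in (0 : ℝ)..t, B s) := by
      rw [← intervalIntegral.integral_add (ii _ hψ0) (ii _ hψF),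
        ← intervalIntegral.integral_sub (ii _ hψA) 
          (ii (fun t => ψ t * A 0 + ψ t * ∫ s in (0 : ℝ)..t, B s) (hψ0.add hψF))]
      refine intervalIntegral.integral_congr fun t _ => ?_
      simp only [hD]
      ring
    rw [e5, e6, intervalIntegral.integral_mul_const]
    simp only [hP] at hw
    linarith
  have hIoo : ∀ t ∈ Ioo 0 T, D t = 0 := fun t ht =>
    Measure.eqOn_open_of_ae_eq (f := D) (g := fun _ => 0) (μ := volume)
      ((ae_restrict_iff' measurableSet_Ioo).mpr hzero) isOpen_Ioo hDc.continuousOn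
      continuousOn_const ht
  intro t ht
  have hcl : t ∈ closure (Ioo 0 T) := by rwa [closure_Ioo hT.ne]
  exact sub_eq_zero.mp (closure_minimal (t := {t | D t = 0}) hIoo
    (isClosed_eq hDc continuous_const) hcl)

theorem eq_add_integral_of_weak {T : ℝ} (hT : 0 < T) {A B : ℝ → ℝ}
    (hA : ContinuousOn A (Icc 0 T)) (hB : ContinuousOn B (Icc 0 T))
    (h : ∀ η : ℝ → ℝ, ContDiff ℝ ∞ η → HasCompactSupport η → tsupport η ⊆ Iio T →
      (∫ t in Ioo 0 T, (deriv η t * A t + η t * B t)) + η 0 * A 0 = 0) :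
    ∀ t ∈ Icc 0 T, A t = A 0 + ∫ s in (0 : ℝ)..t, B s := by
  have ext : ∀ g : ℝ → ℝ, ContinuousOn g (Icc 0 T) →
      ∃ g' : ℝ → ℝ, Continuous g' ∧ ∀ t ∈ Icc 0 T, g' t = g t := fun g hg =>
    ⟨IccExtend hT.le ((Icc 0 T).domRestrict g),
      (continuousOn_iff_continuous_domRestrict.mp hg).Icc_extend',
      fun t ht => IccExtend_of_mem _ _ ht⟩
  obtain ⟨A', hA', eA⟩ := ext A hA
  obtain ⟨B', hB', eB⟩ := ext B hB
  have h0 : (0 : ℝ) ∈ Icc 0 T := ⟨le_rfl, hT.le⟩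
  have key := eq_add_integral_of_weak_of_continuous hT hA' hB' (fun η h1 h2 h3 => by
    refine Eq.trans ?_ (h η h1 h2 h3)
    rw [eA 0 h0]
    congr 1
    refine setIntegral_congr_fun measurableSet_Ioo fun t ht => ?_
    simp only [eA t (Ioo_subset_Icc_self ht), eB t (Ioo_subset_Icc_self ht)])
  intro t ht
  have := key t ht
  rw [eA t ht, eA 0 h0] at this
  rw [this]
  congr 1
  refine intervalIntegral.integral_congr fun s hs => eB s ?_
  rw [uIcc_of_le ht.1] at hs
  exact ⟨hs.1, hs.2.trans ht.2⟩

/-! ### Weak gradients and test functions -/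

/-- The `i`-th partial derivative. -/
def partialDeriv (i : Fin d) (ψ : Space d → ℝ) (x : Space d) : ℝ :=
  fderiv ℝ ψ x (EuclideanSpace.single i 1)

/-- The Laplacian, as a sum of second partial derivatives. -/
def lapl (ψ : Space d → ℝ) (x : Space d) : ℝ := ∑ i, partialDeriv i (partialDeriv i ψ) x

theorem partialDeriv_contDiff {ψ : Space d → ℝ} (h : ContDiff ℝ ∞ ψ) (i : Fin d) :
    ContDiff ℝ ∞ (partialDeriv i ψ) :=
  (h.fderiv_right (m := ∞) (by simp)).clm_apply contDiff_const

theorem partialDeriv_hasCompactSupport {ψ : Space d → ℝ} (h : HasCompactSupport ψ) (i : Fin d) :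
    HasCompactSupport (partialDeriv i ψ) := h.fderiv_apply (𝕜 := ℝ) _

theorem lapl_continuous {ψ : Space d → ℝ} (h : ContDiff ℝ ∞ ψ) : Continuous (lapl ψ) :=
  continuous_finsetSum _ fun i _ =>
    (partialDeriv_contDiff (partialDeriv_contDiff h i) i).continuous

theorem lapl_hasCompactSupport {ψ : Space d → ℝ} (h : HasCompactSupport ψ) :
    HasCompactSupport (lapl ψ) := by
  refine HasCompactSupport.intro' h.isCompact (isClosed_tsupport ψ) fun x hx => ?_
  refine Finset.sum_eq_zero fun i _ => ?_
  refine image_eq_zero_of_notMem_tsupport fun hx' => hx ?_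
  exact tsupport_fderiv_apply_subset ℝ (EuclideanSpace.single i 1)
    (tsupport_fderiv_apply_subset ℝ (EuclideanSpace.single i 1) hx')

theorem gradient_apply (ψ : Space d → ℝ) (x : Space d) (i : Fin d) :
    gradient ψ x i = partialDeriv i ψ x := by
  have h : ⟪gradient ψ x, EuclideanSpace.single i (1 : ℝ)⟫ = partialDeriv i ψ x :=
    inner_gradient_left ..
  rw [← h, EuclideanSpace.inner_single_right]
  simp

theorem gradient_continuous {ψ : Space d → ℝ} (h : ContDiff ℝ ∞ ψ) : Continuous (gradient ψ) :=
  (InnerProductSpace.toDual ℝ (Space d)).symm.continuous.comp (h.continuous_fderiv (by simp))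

theorem gradient_hasCompactSupport {ψ : Space d → ℝ} (h : HasCompactSupport ψ) :
    HasCompactSupport (gradient ψ) :=
  (h.fderiv (𝕜 := ℝ)).comp_left (g := (InnerProductSpace.toDual ℝ (Space d)).symm) (by simp)

/-- The weak gradient identity is applied to each `∂ᵢψ`, its `i`-th component is taken, and the
results are summed. With both derivatives on `ψ`, the diffusive term is continuous in time along
`L²` paths and needs no bound on `∇ρ`. -/
theorem IsWeakGradient.integral_inner_gradient {f : L2 d} {G : L2Vec d} (h : IsWeakGradient f G)
    {ψ : Space d → ℝ} (h1 : ContDiff ℝ ∞ ψ) (h2 : HasCompactSupport ψ) :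
    ∫ x, ⟪G x, gradient ψ x⟫ = -∫ x, f x * lapl ψ x := by
  have hi : ∀ i, ∫ x, f x * partialDeriv i (partialDeriv i ψ) x
      = -∫ x, partialDeriv i ψ x * G x i := fun i => by
    have hp1 := partialDeriv_contDiff h1 i
    have hp2 := partialDeriv_hasCompactSupport h2 i
    have e1 := integral_inner (𝕜 := ℝ) (integrable_smul_of_memLp_two (Lp.memLp f)
      (memLp_gradient_test hp1 hp2)) (EuclideanSpace.single i (1 : ℝ))
    have e2 := integral_inner (𝕜 := ℝ) (integrable_smul_of_memLp_two (memLp_test hp1 hp2)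
      (Lp.memLp G)) (EuclideanSpace.single i (1 : ℝ))
    rw [h _ hp1 hp2, inner_neg_right, ← e2] at e1
    simpa [inner_smul_right, EuclideanSpace.inner_single_left, gradient_apply, partialDeriv]
      using e1
  have hGi : ∀ i, MemLp (fun x => G x i) 2 volume := fun i =>
    (Lp.memLp G).of_le (((EuclideanSpace.proj (𝕜 := ℝ) i).continuous.comp_aestronglyMeasurable
      (Lp.aestronglyMeasurable G))) (Eventually.of_forall fun x => PiLp.norm_apply_le _ i)
  have e3 : ∀ x, ⟪G x, gradient ψ x⟫ = ∑ i, partialDeriv i ψ x * G x i := fun x => by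
    rw [PiLp.inner_apply]
    simp [gradient_apply]
  have i1 : ∀ i ∈ Finset.univ, Integrable (fun x => partialDeriv i ψ x * G x i) volume :=
    fun i _ => (memLp_test (partialDeriv_contDiff h1 i)
      (partialDeriv_hasCompactSupport h2 i)).integrable_mul (hGi i)
  have i2 : ∀ i ∈ Finset.univ,
      Integrable (fun x => f x * partialDeriv i (partialDeriv i ψ) x) volume :=
    fun i _ => (Lp.memLp f).integrable_mul (memLp_test
      (partialDeriv_contDiff (partialDeriv_contDiff h1 i) i)
      (partialDeriv_hasCompactSupport (partialDeriv_hasCompactSupport h2 i) i))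
  simp_rw [e3, lapl, Finset.mul_sum]
  rw [integral_finsetSum _ i1, integral_finsetSum _ i2, ← Finset.sum_neg_distrib]
  exact Finset.sum_congr rfl fun i _ => by rw [hi i, neg_neg]

theorem isWeakGradient_weakGrad {f : L2 d} (h : ∃ G, IsWeakGradient f G) :
    IsWeakGradient f (weakGrad f) := by
  rw [weakGrad, dif_pos h]
  exact h.choose_spec

/-! ### The equation tested against a function of space -/

/-- The right hand side of the equation for `t ↦ ∫ ρ(t) ψ`. -/
def testedRHS (σ₁ σ₂ ν : ℝ) (f : L2 d) (ψ : Space d → ℝ) : ℝ :=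
  (∫ x, f x * ⟪velocity σ₁ f x, gradient ψ x⟫) + (σ₁ + σ₂) * (∫ x, f x * (f x * ψ x))
    + ν * ∫ x, f x * lapl ψ x

/-- Here `p` and `q` stand for `η'(t)` and `η(t)` in a test function `η(t) ψ(x)`. If `ν = 0`, the
value of `weakGrad f` may be meaningless, but its coefficient vanishes. -/
theorem integral_weakForm_integrand {σ₁ σ₂ ν : ℝ} {f : L2 d}
    (hf : 0 < ν → ∃ G, IsWeakGradient f G) (hν : 0 ≤ ν)
    {ψ : Space d → ℝ} (h1 : ContDiff ℝ ∞ ψ) (h2 : HasCompactSupport ψ)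
    (hv : MemLp (fun x => ⟪velocity σ₁ f x, gradient ψ x⟫) 2 volume) (p q : ℝ) :
    ∫ x, (f x * (p * ψ x) + f x * ⟪velocity σ₁ f x, q • gradient ψ x⟫
        + (σ₁ + σ₂) * f x ^ 2 * (q * ψ x) - ν * ⟪weakGrad f x, q • gradient ψ x⟫)
      = p * (∫ x, f x * ψ x) + q * testedRHS σ₁ σ₂ ν f ψ := by
  obtain ⟨W, hW⟩ := h2.exists_bound_of_continuous h1.continuous
  have i1 : Integrable (fun x => f x * ψ x) volume := (Lp.memLp f).integrable_mul (memLp_test h1 h2)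
  have i2 : Integrable (fun x => f x * ⟪velocity σ₁ f x, gradient ψ x⟫) volume :=
    (Lp.memLp f).integrable_mul hv
  have i3 : Integrable (fun x => f x * (f x * ψ x)) volume :=
    (Lp.memLp f).integrable_mul (memLp_mul_bounded f h1.continuous.aestronglyMeasurable hW)
  have i4 : Integrable (fun x => ⟪weakGrad f x, gradient ψ x⟫) volume := by
    refine ((Lp.memLp (weakGrad f)).norm.integrable_mul (memLp_gradient_test h1 h2).norm).mono'
      ((Lp.aestronglyMeasurable _).inner (gradient_continuous h1).aestronglyMeasurable)
      (Eventually.of_forall fun x => norm_inner_le_norm _ _)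
  have e4 : ν * ∫ x, ⟪weakGrad f x, gradient ψ x⟫ = -(ν * ∫ x, f x * lapl ψ x) := by
    rcases hν.eq_or_lt with h0 | h0
    · simp [← h0]
    · rw [(isWeakGradient_weakGrad (hf h0)).integral_inner_gradient h1 h2, mul_neg]
  have e : ∀ x, f x * (p * ψ x) + f x * ⟪velocity σ₁ f x, q • gradient ψ x⟫
        + (σ₁ + σ₂) * f x ^ 2 * (q * ψ x) - ν * ⟪weakGrad f x, q • gradient ψ x⟫
      = p * (f x * ψ x) + q * (f x * ⟪velocity σ₁ f x, gradient ψ x⟫)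
        + q * (σ₁ + σ₂) * (f x * (f x * ψ x)) - q * ν * ⟪weakGrad f x, gradient ψ x⟫ := fun x => by
    rw [inner_smul_right, inner_smul_right]
    ring
  simp_rw [e]
  have j1 := i1.const_mul p
  have j2 := i2.const_mul q
  have j3 := i3.const_mul (q * (σ₁ + σ₂))
  have j12 : Integrable (fun x => p * (f x * ψ x)
      + q * (f x * ⟪velocity σ₁ f x, gradient ψ x⟫)) volume := j1.add j2
  have j123 : Integrable (fun x => p * (f x * ψ x) + q * (f x * ⟪velocity σ₁ f x, gradient ψ x⟫)
      + q * (σ₁ + σ₂) * (f x * (f x * ψ x))) volume := j12.add j3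
  rw [integral_sub j123 (i4.const_mul _),
    integral_add j12 j3, integral_add j1 j2, integral_const_mul, integral_const_mul,
    integral_const_mul, integral_const_mul, mul_assoc q ν, e4, testedRHS]
  ring

theorem continuousOn_testedRHS (hd : 2 ≤ d) (σ₁ σ₂ ν : ℝ) {S : Set ℝ} {ρ : ℝ → L2 d} {M : ℝ≥0}
    (h : BoundedOn S ρ M) (hρ : ContinuousOn ρ S) {ψ : Space d → ℝ} (h1 : ContDiff ℝ ∞ ψ)
    (h2 : HasCompactSupport ψ) : ContinuousOn (fun t => testedRHS σ₁ σ₂ ν (ρ t) ψ) S := by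
  obtain ⟨W, hW⟩ := h2.exists_bound_of_continuous h1.continuous
  exact ((h.continuousOn_integral_flux hd σ₁ hρ (memLp_gradient_test h1 h2)).add
    ((continuousOn_integral_mul_mul hρ h1.continuous.aestronglyMeasurable (W := W.toNNReal)
      fun x => (hW x).trans (Real.le_coe_toNNReal W)).const_mul _)).add
    ((continuousOn_integral_mul_const hρ ((lapl_continuous h1).memLp_of_hasCompactSupport
      (lapl_hasCompactSupport h2))).const_mul _)

theorem IsWeakSolution.integral_mul_eq (hd : 2 ≤ d) {σ₁ σ₂ ν T : ℝ} (hν : 0 ≤ ν) (hT : 0 < T)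
    {ρ₀ : Space d → ℝ} {ρ : ℝ → L2 d} (hρ : IsWeakSolution σ₁ σ₂ ν T ρ₀ ρ) {M : ℝ≥0}
    (hM : BoundedOn (Icc 0 T) ρ M) {ψ : Space d → ℝ} (h1 : ContDiff ℝ ∞ ψ)
    (h2 : HasCompactSupport ψ) : ∀ t ∈ Icc 0 T,
      ∫ x, ρ t x * ψ x = (∫ x, ρ 0 x * ψ x) + ∫ s in (0 : ℝ)..t, testedRHS σ₁ σ₂ ν (ρ s) ψ := by
  refine eq_add_integral_of_weak hT (A := fun t => ∫ x, ρ t x * ψ x)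
    (continuousOn_integral_mul_const hρ.continuous (memLp_test h1 h2))
    (continuousOn_testedRHS hd σ₁ σ₂ ν hM hρ.continuous h1 h2) fun η hη1 hη2 hη3 => ?_
  set φ : ℝ × Space d → ℝ := fun p => η p.1 * ψ p.2 with hφ
  have hsupp : Function.support φ ⊆ tsupport η ×ˢ tsupport ψ := fun p hp =>
    ⟨subset_tsupport η (left_ne_zero_of_mul hp), subset_tsupport ψ (right_ne_zero_of_mul hp)⟩
  have hφ1 : ContDiff ℝ ∞ φ := (hη1.comp contDiff_fst).mul (h1.comp contDiff_snd)
  have hφ2 : HasCompactSupport φ :=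
    HasCompactSupport.of_support_subset_isCompact (hη2.isCompact.prod h2.isCompact) hsupp
  have hφ3 : tsupport φ ⊆ Iio T ×ˢ univ :=
    (closure_minimal hsupp ((isClosed_tsupport η).prod (isClosed_tsupport ψ))).trans
      (prod_mono hη3 (subset_univ _))
  have key := hρ.weakForm φ hφ1 hφ2 hφ3
  have hgrad : 0 < ν → ∀ᵐ t ∂(volume.restrict (Ioo 0 T)), ∃ G, IsWeakGradient (ρ t) G := by
    intro h0
    obtain ⟨u, -, hu⟩ := hρ.sobolev h0
    filter_upwards [hu] with t ht
    rw [← ht]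
    exact ⟨_, (u t).2⟩
  have hgrad' : ∀ᵐ t ∂(volume.restrict (Ioo 0 T)), 0 < ν → ∃ G, IsWeakGradient (ρ t) G := by
    by_cases h0 : 0 < ν
    · filter_upwards [hgrad h0] with t ht _ using ht
    · exact Eventually.of_forall fun t h => absurd h h0
  have e0 : ∫ x, ρ₀ x * φ (0, x) = η 0 * ∫ x, ρ 0 x * ψ x := by
    rw [← integral_const_mul]
    refine integral_congr_ae ?_
    filter_upwards [hρ.initial] with x hx
    simp only [hφ, hx]
    ring
  rw [e0] at key
  refine Eq.trans ?_ key
  congr 1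
  refine integral_congr_ae ?_
  filter_upwards [hgrad', ae_restrict_mem measurableSet_Ioo] with t ht htI
  rw [← integral_weakForm_integrand ht hν h1 h2 (hM.memLp_inner_velocity hd σ₁
    (Ioo_subset_Icc_self htI) (memLp_gradient_test h1 h2))]
  congr 1
  funext x
  have d1 : deriv (fun s => φ (s, x)) t = deriv η t * ψ x :=
    ((hη1.differentiable (by simp) t).hasDerivAt.mul_const (ψ x)).deriv
  have d2 : gradient (fun y => φ (t, y)) x = η t • gradient ψ x := by
    have : fderiv ℝ (fun y => φ (t, y)) x = η t • fderiv ℝ ψ x :=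
      ((h1.differentiable (by simp) x).hasFDerivAt.const_mul (η t)).fderiv
    rw [gradient, this, map_smul]
    rfl
  rw [d1, d2]

/-! ### Rescaled cutoff functions -/

namespace IsRadialCutoff

variable {a : Space d → ℝ}

theorem hasCompactSupport (ha : IsRadialCutoff a) : HasCompactSupport a :=
  HasCompactSupport.of_support_subset_isCompact (isCompact_closedBall 0 2)
    (ha.support_subset.trans Metric.ball_subset_closedBall)

theorem contDiff_aR (ha : IsRadialCutoff a) (R : ℝ) : ContDiff ℝ ∞ (aR a R) :=
  ha.smooth.comp (contDiff_id.const_smul R⁻¹)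

theorem hasCompactSupport_aR (ha : IsRadialCutoff a) {R : ℝ} (hR : R ≠ 0) :
    HasCompactSupport (aR a R) :=
  ha.hasCompactSupport.comp_smul (inv_ne_zero hR)

theorem tendsto_aR (ha : IsRadialCutoff a) (x : Space d) :
    Tendsto (fun R => aR a R x) atTop (𝓝 1) := by
  refine tendsto_const_nhds.congr' ?_
  filter_upwards [eventually_gt_atTop ‖x‖, eventually_gt_atTop 0] with R hR hR0
  refine (ha.eq_one _ ?_).symm
  rw [mem_ball_zero_iff, norm_smul, norm_inv, Real.norm_of_nonneg hR0.le, inv_mul_lt_one₀ hR0]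
  exact hR

end IsRadialCutoff

theorem gradient_aR (a : Space d → ℝ) (R : ℝ) (x : Space d) :
    gradient (aR a R) x = R⁻¹ • gradient a (R⁻¹ • x) := by
  have h : fderiv ℝ (aR a R) x = R⁻¹ • fderiv ℝ a (R⁻¹ • x) := fderiv_comp_smul ..
  rw [gradient, h, map_smul]
  rfl

theorem partialDeriv_comp_smul (i : Fin d) (f : Space d → ℝ) (c : ℝ) (x : Space d) :
    partialDeriv i (fun y => f (c • y)) x = c * partialDeriv i f (c • x) := by
  have h : fderiv ℝ (fun y => f (c • y)) x = c • fderiv ℝ f (c • x) := fderiv_comp_smul ..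
  rw [partialDeriv, h]
  rfl

theorem lapl_aR {a : Space d → ℝ} (ha : ContDiff ℝ ∞ a) (R : ℝ) (x : Space d) :
    lapl (aR a R) x = R⁻¹ ^ 2 * lapl a (R⁻¹ • x) := by
  rw [lapl, lapl, Finset.mul_sum]
  refine Finset.sum_congr rfl fun i _ => ?_
  have e : partialDeriv i (aR a R) = fun y => R⁻¹ * partialDeriv i a (R⁻¹ • y) :=
    funext fun y => partialDeriv_comp_smul i a R⁻¹ y
  have hd : DifferentiableAt ℝ (fun y => partialDeriv i a (R⁻¹ • y)) x :=
    (((partialDeriv_contDiff ha i).comp (contDiff_id.const_smul R⁻¹)).differentiable (by simp)) x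
  have e2 : partialDeriv i (fun y => R⁻¹ * partialDeriv i a (R⁻¹ • y)) x
      = R⁻¹ * partialDeriv i (fun y => partialDeriv i a (R⁻¹ • y)) x := by
    rw [partialDeriv, (hd.hasFDerivAt.const_mul R⁻¹).fderiv]
    rfl
  rw [e, e2, partialDeriv_comp_smul]
  ring

/-! ### Removing the cutoff -/

theorem norm_integral_mul_le {f g : Space d → ℝ} (hf : Integrable f volume) {c m : ℝ}
    (hm : ∫ x, ‖f x‖ ≤ m) (hc : 0 ≤ c) (hg : ∀ x, ‖g x‖ ≤ c) : ‖∫ x, f x * g x‖ ≤ m * c := by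
  refine (norm_integral_le_of_norm_le (hf.norm.mul_const c) (Eventually.of_forall fun x => ?_)).trans
    ?_
  · rw [norm_mul]
    gcongr
    exact hg x
  · rw [integral_mul_const]
    gcongr

theorem integral_mul_self_eq (f : L2 d) : ∫ x, f x * f x = ‖f‖ ^ 2 := by
  rw [← real_inner_self_eq_norm_sq, L2.inner_def]
  rfl

theorem integrable_mul_self (f : L2 d) : Integrable (fun x => f x * f x) volume :=
  (Lp.memLp f).integrable_mul (Lp.memLp f)

theorem tendsto_integral_mul_aR {a : Space d → ℝ} (ha : IsRadialCutoff a) {f : Space d → ℝ}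
    (hf : Integrable f volume) :
    Tendsto (fun R => ∫ x, f x * aR a R x) atTop (𝓝 (∫ x, f x)) := by
  obtain ⟨W, hW⟩ := ha.hasCompactSupport.exists_bound_of_continuous ha.smooth.continuous
  refine tendsto_integral_filter_of_dominated_convergence (fun x => ‖f x‖ * W)
    (Eventually.of_forall fun R =>
      hf.1.mul (ha.contDiff_aR R).continuous.aestronglyMeasurable)
    (Eventually.of_forall fun R => Eventually.of_forall fun x => ?_) (hf.norm.mul_const W)
    (Eventually.of_forall fun x => ?_)
  · rw [norm_mul]
    gcongr
    exact hW _
  · simpa using (ha.tendsto_aR x).const_mul (f x)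

section Limit

variable {a : Space d → ℝ} {V G L m : ℝ} {f : L2 d}

theorem norm_integral_flux_aR_le {σ : ℝ} (hG : ∀ x, ‖gradient a x‖ ≤ G) (hf : Integrable f volume)
    (hm : ∫ x, ‖f x‖ ≤ m) (hv : ∀ x, ‖velocity σ f x‖ ≤ V) {R : ℝ} (hR : 0 < R) :
    ‖∫ x, f x * ⟪velocity σ f x, gradient (aR a R) x⟫‖ ≤ m * (V * (R⁻¹ * G)) := by
  have hG0 : 0 ≤ G := (norm_nonneg _).trans (hG 0)
  have hV0 : 0 ≤ V := (norm_nonneg _).trans (hv 0)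
  refine norm_integral_mul_le hf hm (by positivity) fun x => (norm_inner_le_norm _ _).trans ?_
  rw [gradient_aR, norm_smul, norm_inv, Real.norm_of_nonneg hR.le]
  gcongr
  · exact hv x
  · exact hG _

theorem norm_integral_lapl_aR_le (ha : ContDiff ℝ ∞ a) (hL : ∀ x, ‖lapl a x‖ ≤ L)
    (hf : Integrable f volume) (hm : ∫ x, ‖f x‖ ≤ m) (R : ℝ) :
    ‖∫ x, f x * lapl (aR a R) x‖ ≤ m * (R⁻¹ ^ 2 * L) := by
  have hL0 : 0 ≤ L := (norm_nonneg _).trans (hL 0)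
  refine norm_integral_mul_le hf hm (by positivity) fun x => ?_
  rw [lapl_aR ha, norm_mul, Real.norm_of_nonneg (by positivity)]
  gcongr
  exact hL _

/-- Flux and diffusion are squeezed by multiples of `R⁻¹` and `R⁻²`; only the quadratic term
survives. -/
theorem tendsto_testedRHS {σ₁ σ₂ ν : ℝ} (ha : IsRadialCutoff a) (hG : ∀ x, ‖gradient a x‖ ≤ G)
    (hL : ∀ x, ‖lapl a x‖ ≤ L) (hf : Integrable f volume) (hv : ∀ x, ‖velocity σ₁ f x‖ ≤ V) :
    Tendsto (fun R => testedRHS σ₁ σ₂ ν f (aR a R)) atTop (𝓝 ((σ₁ + σ₂) * ‖f‖ ^ 2)) := by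
  have hinv : Tendsto (fun R : ℝ => R⁻¹) atTop (𝓝 0) := tendsto_inv_atTop_zero
  have h1 : Tendsto (fun R => ∫ x, f x * ⟪velocity σ₁ f x, gradient (aR a R) x⟫) atTop (𝓝 0) := by
    refine squeeze_zero_norm' (a := fun R => (∫ x, ‖f x‖) * (V * (R⁻¹ * G))) ?_ ?_
    · filter_upwards [eventually_gt_atTop 0] with R hR
      exact norm_integral_flux_aR_le hG hf le_rfl hv hR
    · simpa using ((hinv.mul_const G).const_mul V).const_mul (∫ x, ‖f x‖)
  have h2 : Tendsto (fun R => ∫ x, f x * lapl (aR a R) x) atTop (𝓝 0) := by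
    refine squeeze_zero_norm (a := fun R => (∫ x, ‖f x‖) * (R⁻¹ ^ 2 * L))
      (fun R => norm_integral_lapl_aR_le ha.smooth hL hf le_rfl R) ?_
    simpa using ((hinv.pow 2).mul_const L).const_mul (∫ x, ‖f x‖)
  have h3 : Tendsto (fun R => ∫ x, f x * (f x * aR a R x)) atTop (𝓝 (‖f‖ ^ 2)) := by
    rw [← integral_mul_self_eq]
    simpa only [mul_assoc] using tendsto_integral_mul_aR ha (integrable_mul_self f)
  have h := (h1.add (h3.const_mul (σ₁ + σ₂))).add (h2.const_mul ν)
  rw [zero_add, mul_zero, add_zero] at h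
  exact h

/-- A bound free of `R`, serving as the dominating function for the time integral; `1 ≤ R` lets the
factors `R⁻¹` and `R⁻²` be dropped. -/
theorem norm_testedRHS_le {σ₁ σ₂ ν W : ℝ} (ha : IsRadialCutoff a) (hW : ∀ x, ‖a x‖ ≤ W)
    (hG : ∀ x, ‖gradient a x‖ ≤ G) (hL : ∀ x, ‖lapl a x‖ ≤ L) (hf : Integrable f volume)
    (hm : ∫ x, ‖f x‖ ≤ m) (hv : ∀ x, ‖velocity σ₁ f x‖ ≤ V) {R : ℝ} (hR : 1 ≤ R) :
    ‖testedRHS σ₁ σ₂ ν f (aR a R)‖ ≤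
      m * (V * G) + ‖σ₁ + σ₂‖ * (‖f‖ ^ 2 * W) + ‖ν‖ * (m * L) := by
  have hW0 : 0 ≤ W := (norm_nonneg _).trans (hW 0)
  have hG0 : 0 ≤ G := (norm_nonneg _).trans (hG 0)
  have hL0 : 0 ≤ L := (norm_nonneg _).trans (hL 0)
  have hV0 : 0 ≤ V := (norm_nonneg _).trans (hv 0)
  have hm0 : 0 ≤ m := (integral_nonneg fun x => norm_nonneg _).trans hm
  have hR0 : 0 < R := by linarith
  have hRi : R⁻¹ ≤ 1 := inv_le_one_of_one_le₀ hR
  have hRi0 : 0 ≤ R⁻¹ := by positivity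
  have h1 := norm_integral_flux_aR_le hG hf hm hv hR0
  have h2 := norm_integral_lapl_aR_le ha.smooth hL hf hm R
  have h3 : ‖∫ x, f x * (f x * aR a R x)‖ ≤ ‖f‖ ^ 2 * W := by
    simp only [← mul_assoc]
    refine norm_integral_mul_le (integrable_mul_self f) (le_of_eq ?_) hW0 fun x => hW _
    rw [← integral_mul_self_eq]
    simp
  refine (norm_add_le _ _).trans (add_le_add ((norm_add_le _ _).trans (add_le_add ?_ ?_)) ?_)
  · refine h1.trans ?_
    gcongr
    exact mul_le_of_le_one_left hG0 hRi
  · rw [norm_mul]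
    gcongr
  · rw [norm_mul]
    gcongr
    refine h2.trans ?_
    gcongr
    exact mul_le_of_le_one_left hL0 (pow_le_one₀ hRi0 hRi)

end Limit

/-- The total mass identity. A density that is bounded in `L¹ ∩ L^∞` has a bounded velocity, so the
flux through the cutoff is `O(1 / R)`, and the diffusive term is `O(1 / R²)`: no decay of the initial
density beyond integrability is needed. -/
theorem IsWeakSolution.integral_eq (hd : 2 ≤ d) {σ₁ σ₂ ν T : ℝ} (hν : 0 ≤ ν) (hT : 0 < T)
    {a : Space d → ℝ} (ha : IsRadialCutoff a)
    {ρ₀ : Space d → ℝ} {ρ : ℝ → L2 d} (hρ : IsWeakSolution σ₁ σ₂ ν T ρ₀ ρ) {M : ℝ≥0}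
    (hM : BoundedOn (Icc 0 T) ρ M) : ∀ t ∈ Icc 0 T,
      ∫ x, ρ t x = (∫ x, ρ 0 x) + (σ₁ + σ₂) * ∫ s in (0 : ℝ)..t, ‖ρ s‖ ^ 2 := by
  obtain ⟨W, hW⟩ := ha.hasCompactSupport.exists_bound_of_continuous ha.smooth.continuous
  obtain ⟨G, hG⟩ := (gradient_hasCompactSupport ha.hasCompactSupport).exists_bound_of_continuous
    (gradient_continuous ha.smooth)
  obtain ⟨L, hL⟩ := (lapl_hasCompactSupport ha.hasCompactSupport).exists_bound_of_continuous
    (lapl_continuous ha.smooth)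
  obtain ⟨V, -, hV⟩ := hM.exists_velocity_le hd σ₁ isCompact_Icc hρ.continuous
  obtain ⟨B, hB⟩ := isCompact_Icc.exists_bound_of_continuousOn hρ.continuous
  have hW0 : 0 ≤ W := (norm_nonneg _).trans (hW 0)
  intro t ht
  have h0 : (0 : ℝ) ∈ Icc 0 T := ⟨le_rfl, hT.le⟩
  have hsub : uIoc 0 t ⊆ Icc 0 T := fun s hs => by
    rw [uIoc_of_le ht.1] at hs
    exact ⟨hs.1.le, hs.2.trans ht.2⟩
  have hlim : Tendsto (fun R => ∫ s in (0 : ℝ)..t, testedRHS σ₁ σ₂ ν (ρ s) (aR a R)) atTop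
      (𝓝 (∫ s in (0 : ℝ)..t, (σ₁ + σ₂) * ‖ρ s‖ ^ 2)) := by
    refine intervalIntegral.tendsto_integral_filter_of_dominated_convergence
      (fun _ => M * (V * G) + ‖σ₁ + σ₂‖ * (B ^ 2 * W) + ‖ν‖ * (M * L)) ?_ ?_
      intervalIntegrable_const ?_
    · filter_upwards [eventually_gt_atTop 0] with R hR
      exact ((continuousOn_testedRHS hd σ₁ σ₂ ν hM hρ.continuous (ha.contDiff_aR R)
        (ha.hasCompactSupport_aR hR.ne')).mono hsub).aestronglyMeasurable measurableSet_uIoc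
    · filter_upwards [eventually_ge_atTop 1] with R hR
      refine Eventually.of_forall fun s hs => ?_
      refine (norm_testedRHS_le ha hW hG hL (hM.integrable (hsub hs))
        (hM.integral_norm_le (hsub hs)) (hV s (hsub hs)) hR).trans ?_
      gcongr
      exact hB s (hsub hs)
    · exact Eventually.of_forall fun s hs => tendsto_testedRHS ha hG hL
        (hM.integrable (hsub hs)) (hV s (hsub hs))
  have hlim2 := (tendsto_integral_mul_aR ha (hM.integrable h0)).add hlim
  rw [intervalIntegral.integral_const_mul] at hlim2
  -- For `R > 0` the tested identity equates the two families, so their limits agree.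
  refine tendsto_nhds_unique ((tendsto_integral_mul_aR ha (hM.integrable ht)).congr' ?_) hlim2
  filter_upwards [eventually_gt_atTop 0] with R hR
  exact hρ.integral_mul_eq hd hν hT hM (ha.contDiff_aR R) (ha.hasCompactSupport_aR hR.ne') t ht

end GAG

end

theorem mainTheorem9 {d : ℕ} (hd : 2 ≤ d) {σ₁ σ₂ ν T : ℝ} (hσ₁ : σ₁ ≠ 0) (hν : 0 ≤ ν) (hT : 0 < T)
    (a : GAG.Space d → ℝ) (ha : GAG.IsRadialCutoff a)
    (ρ₀ : GAG.Space d → ℝ) (hρ₀_one : MemLp ρ₀ 1 volume) (hρ₀_top : MemLp ρ₀ ∞ volume)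
    {C N R₀ : ℝ} (hN : (d : ℝ) + 1 < N) (hR₀ : 0 < R₀)
    (hdecay : ∀ R : ℝ, R₀ ≤ R →
      (lpNorm (fun x => GAG.bR a R x * ρ₀ x) 2 volume) ^ 2 ≤ C * R ^ (-N))
    (ρ : ℝ → GAG.L2 d) (hρ : GAG.IsWeakSolution σ₁ σ₂ ν T ρ₀ ρ) :
    (∀ t ∈ Icc 0 T, Integrable (ρ t) volume ∧
      GAG.totalMass (ρ t) = GAG.totalMass ρ₀ + (σ₁ + σ₂) * ∫ s in (0 : ℝ)..t, ‖ρ s‖ ^ 2) ∧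
    ((∃ t ∈ Icc 0 T, ρ t ≠ 0) →
      ((∀ t ∈ Icc 0 T, GAG.totalMass (ρ t) = GAG.totalMass ρ₀) ↔ σ₁ + σ₂ = 0)) := by
  obtain ⟨M, hM⟩ := hρ.bounded.exists_boundedOn hT hρ.continuous
  have hmass : ∀ t ∈ Icc 0 T,
      GAG.totalMass (ρ t) = GAG.totalMass ρ₀ + (σ₁ + σ₂) * ∫ s in (0 : ℝ)..t, ‖ρ s‖ ^ 2 :=
    fun t ht => by
      rw [GAG.totalMass, GAG.totalMass, ← integral_congr_ae hρ.initial]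
      exact hρ.integral_eq hd hν hT ha hM t ht
  refine ⟨fun t ht => ⟨hM.integrable ht, hmass t ht⟩, fun ⟨t₀, ht₀, hne⟩ => ⟨fun h => ?_, ?_⟩⟩
  -- Continuity spreads a single nonzero time into a positive integral, so conservation at the final
  -- time `T` alone forces `σ₁ + σ₂ = 0`.
  · have hpos : 0 < ∫ s in (0 : ℝ)..T, ‖ρ s‖ ^ 2 :=
      intervalIntegral.integral_pos hT (hρ.continuous.norm.pow 2) (fun s _ => by positivity)
        ⟨t₀, ht₀, by positivity⟩
    have hTm : T ∈ Icc 0 T := ⟨hT.le, le_rfl⟩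
    have e := (hmass T hTm).symm.trans (h T hTm)
    exact (mul_eq_zero.mp (add_eq_left.mp e)).resolve_right hpos.ne'
  · intro h t ht
    rw [hmass t ht, h, zero_mul, add_zero]
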